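/- **Theorem 1.7.** Let $s\ge 2$, let $(\vec u,\vec t,\vec v)=(u_1,\dots,u_s,t_1,\dots,t_s,v_1,\dots,v_s)$ be the coordinates on $M_{3s}:=\mathbb{R}^{3s}$, and let $g_{3s}$ be the pseudo-Riemannian metric whose components are, for $1\le i,j\le s$, $$g_{3s}(\partial_i^u,\partial_j^u)=-2\delta_{ij}\sum_{k=1}^s u_kt_k,\qquad g_{3s}(\partial_i^u,\partial_j^v)=g_{3s}(\partial_j^v,\partial_i^u)=\delta_{ij},\qquad g_{3s}(\partial_i^t,\partial_j^t)=-\delta_{ij},$$ all other components being zero. It has signature $(2s,s)$, i.e. $2s$ minus signs and $s$ plus signs. Definitions. Let $R$ be the curvature of the Levi-Civita connection of a pseudo-Riemannian manifold $(M,g)$, with curvature operators $R(x,y)\in\operatorname{End}(T_PM)$. A plane in $T_PM$ is spacelike (timelike) if $g_P$ is positive (negative) definite on it; a basis $\{e_i\}$ of it is orthonormal if $g_P(e_i,e_j)=\delta_{ij}$ (respectively $-\delta_{ij}$). For an oriented spacelike or timelike $2$-plane $\pi$ with oriented orthonormal basis $\{e_1,e_2\}$ put $\mathcal R(\pi):=R(e_1,e_2)$.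 For a spacelike or timelike $k$-plane $\pi$ with orthonormal basis $\{e_1,\dots,e_k\}$ put $\Theta(\pi):=\sum_{i,j=1}^kR(e_i,e_j)R(e_i,e_j)$. Neither depends on the chosen basis. The manifold $(M,g)$ is *spacelike (timelike) Jordan Ivanov-Petrova* if for every $P\in M$ the Jordan normal form (conjugacy class) of $\mathcal R(\pi)$ is the same for all oriented spacelike (timelike) $2$-planes $\pi\subset T_PM$; it has *spacelike rank $r$* if $\operatorname{Rank}\mathcal R(\pi)=r$ for every $P$ and every oriented spacelike $2$-plane $\pi\subset T_PM$. It is *$k$-spacelike ($k$-timelike) Jordan Stanilov* if for every $P\in M$ the Jordan normal form of $\Theta(\pi)$ is the same for all spacelike (timelike) $k$-planes $\pi\subset T_PM$. Then: 1. $(M_{3s},g_{3s})$ is spacelike Jordan Ivanov-Petrova, of spacelike rank $4$. 2. $(M_{3s},g_{3s})$ is not timelike Jordan Ivanov-Petrova. 3. $(M_{3s},g_{3s})$ is $k$-spacelike Jordan Stanilov for every $k$ with $2\le k\le s$. 4. For every $k$ with $2\le k\le 2s$, $(M_{3s},g_{3s})$ is $k$-timelike Jordan Stanilov if and only if $k=2s$.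 -/

import Mathlib

open scoped ContDiff

noncomputable section

/-! ### Algebra: a real inner product space `(V, B)` of arbitrary signature together with a
curvature operator `R : V → V → End V` -/

section Algebra

variable {V : Type*} [AddCommGroup V] [Module ℝ V]

/-- The Grassmannian of unoriented `k`-planes of `(V, B)` which are spacelike (`ε = 1`, that is,
`B` is positive definite on them) or timelike (`ε = -1`, `B` is negative definite on them). -/
structure DefinitePlane (B : LinearMap.BilinForm ℝ V) (ε : ℝ) (k : ℕ) where
  carrier : Submodule ℝ V
  finrank_eq : Module.finrank ℝ carrier = k
  definite : ∀ x ∈ carrier, x ≠ 0 → 0 < ε * B x x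

/-- The Grassmannian of oriented spacelike (`ε = 1`) or timelike (`ε = -1`) `2`-planes. -/
structure OrientedDefinitePlane (B : LinearMap.BilinForm ℝ V) (ε : ℝ) extends
    DefinitePlane B ε 2 where
  orientation : Orientation ℝ carrier (Fin 2)

/-- `e` is an orthonormal basis of the spacelike (`ε = 1`) or timelike (`ε = -1`) plane `W`:
`B (e i) (e j) = ε δ_{ij}`. -/
def IsOrthonormalBasis (B : LinearMap.BilinForm ℝ V) (ε : ℝ) {k : ℕ} {W : Submodule ℝ V}
    (e : Module.Basis (Fin k) ℝ W) : Prop :=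
  ∀ i j, B (e i) (e j) = if i = j then ε else 0

/-- `A` is the skew-symmetric curvature operator of the oriented plane `P`:
`A = R(e₁, e₂)` for an oriented orthonormal basis `e` of `P` (the choice of `e` is immaterial). -/
def IsSkewCurvatureOperator (B : LinearMap.BilinForm ℝ V) (R : V → V → Module.End ℝ V) {ε : ℝ}
    (P : OrientedDefinitePlane B ε) (A : Module.End ℝ V) : Prop :=
  ∃ e : Module.Basis (Fin 2) ℝ P.carrier, IsOrthonormalBasis B ε e ∧
    e.orientation = P.orientation ∧ A = R (e 0) (e 1)

/-- `A` is the higher order curvature operator of the `k`-plane `P`: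
`A = ∑ i j, R(e_i, e_j) R(e_i, e_j)` for an orthonormal basis `e` of `P`
(the choice of `e` is immaterial). -/
def IsHigherCurvatureOperator (B : LinearMap.BilinForm ℝ V) (R : V → V → Module.End ℝ V) {ε : ℝ}
    {k : ℕ} (P : DefinitePlane B ε k) (A : Module.End ℝ V) : Prop :=
  ∃ e : Module.Basis (Fin k) ℝ P.carrier, IsOrthonormalBasis B ε e ∧
    A = ∑ i, ∑ j, R (e i) (e j) * R (e i) (e j)

/-- The rank of the skew-symmetric curvature operator is `r` on all oriented spacelike (`ε = 1`)
or timelike (`ε = -1`) `2`-planes. -/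
def HasConstantSkewRank (B : LinearMap.BilinForm ℝ V) (R : V → V → Module.End ℝ V) (ε : ℝ)
    (r : ℕ) : Prop :=
  ∀ (P : OrientedDefinitePlane B ε) (A : Module.End ℝ V), IsSkewCurvatureOperator B R P A →
    Module.finrank ℝ (LinearMap.range A) = r

/-- Jordan Ivanov-Petrova: the Jordan normal form, i.e. the conjugacy class in `End V`, of the
skew-symmetric curvature operator is constant on the oriented spacelike (`ε = 1`) or timelike
(`ε = -1`) `2`-planes. -/
def IsJordanIvanovPetrova (B : LinearMap.BilinForm ℝ V) (R : V → V → Module.End ℝ V)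
    (ε : ℝ) : Prop :=
  ∀ (P P' : OrientedDefinitePlane B ε) (A A' : Module.End ℝ V),
    IsSkewCurvatureOperator B R P A → IsSkewCurvatureOperator B R P' A' → IsConj A A'

/-- `k`-Jordan Stanilov: the Jordan normal form, i.e. the conjugacy class in `End V`, of the
higher order curvature operator is constant on the spacelike (`ε = 1`) or timelike (`ε = -1`)
`k`-planes. -/
def IsJordanStanilov (B : LinearMap.BilinForm ℝ V) (R : V → V → Module.End ℝ V) (ε : ℝ)
    (k : ℕ) : Prop :=
  ∀ (P P' : DefinitePlane B ε k) (A A' : Module.End ℝ V),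
    IsHigherCurvatureOperator B R P A → IsHigherCurvatureOperator B R P' A' → IsConj A A'

end Algebra

/-! ### Geometry: pseudo-Riemannian metrics on a coordinate space -/

/-- A smooth pseudo-Riemannian metric on the manifold `E` (a finite dimensional real vector space;
all tangent spaces are identified with `E` by the linear coordinates). -/
structure PseudoRiemannianMetric (E : Type*) [NormedAddCommGroup E] [NormedSpace ℝ E] where
  val : E → E →L[ℝ] E →L[ℝ] ℝ
  smooth : ContDiff ℝ ∞ val
  symm : ∀ p x y, val p x y = val p y x
  nondegenerate : ∀ p x, (∀ y, val p x y = 0) → x = 0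

namespace PseudoRiemannianMetric

variable {E : Type*} [NormedAddCommGroup E] [NormedSpace ℝ E]

/-- The inner product on the tangent space at `p`. -/
def form (g : PseudoRiemannianMetric E) (p : E) : LinearMap.BilinForm ℝ E :=
  (g.val p).toBilinForm

/-- `g` has signature `(a, b)`: `a` minus signs and `b` plus signs at each point. -/
def HasSignature (g : PseudoRiemannianMetric E) (a b : ℕ) : Prop :=
  ∀ p, sigNeg (g.form p).toQuadraticMap = a ∧ sigPos (g.form p).toQuadraticMap = b

lemma fderiv_val_symm (g : PseudoRiemannianMetric E) (p x y z : E) :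
    fderiv ℝ g.val p x y z = fderiv ℝ g.val p x z y := by
  have hd : DifferentiableAt ℝ g.val p := (g.smooth.differentiable (by simp)) p
  have h1 := ((hd.hasFDerivAt.clm_apply (hasFDerivAt_const y p)).clm_apply
    (hasFDerivAt_const z p))
  have h2 := ((hd.hasFDerivAt.clm_apply (hasFDerivAt_const z p)).clm_apply
    (hasFDerivAt_const y p))
  have : (fun q => g.val q y z) = fun q => g.val q z y := funext fun q => g.symm q y z
  rw [this] at h1
  simpa using congrArg (fun L : E →L[ℝ] ℝ => L x) (h1.unique h2)

variable [FiniteDimensional ℝ E]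

/-- The isomorphism `x ↦ g_p(x, ·)` from the tangent space to the cotangent space at `p`. -/
def flat (g : PseudoRiemannianMetric E) (p : E) : E ≃L[ℝ] (E →L[ℝ] ℝ) :=
  (LinearMap.linearEquivOfInjective (g.val p : E →ₗ[ℝ] (E →L[ℝ] ℝ))
    ((injective_iff_map_eq_zero _).2 fun x hx =>
      g.nondegenerate p x fun y => by
        have h : g.val p x = 0 := hx
        rw [h]; rfl)
    (by
      rw [← Subspace.dual_finrank_eq]
      exact (LinearMap.toContinuousLinearMap (𝕜 := ℝ) (E := E) (F' := ℝ)).finrank_eq)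
    ).toContinuousLinearEquiv

lemma flat_apply (g : PseudoRiemannianMetric E) (p x : E) : g.flat p x = g.val p x := rfl

lemma val_flat_symm (g : PseudoRiemannianMetric E) (p : E) (f : E →L[ℝ] ℝ) :
    g.val p ((g.flat p).symm f) = f := by
  rw [← flat_apply, ContinuousLinearEquiv.apply_symm_apply]

/-- The Christoffel symbols: `Γ_p(x, y)` is the vector determined by the Koszul formula
`g(Γ(x, y), z) = (D_x g(y, z) + D_y g(x, z) - D_z g(x, y)) / 2`. -/
def christoffel (g : PseudoRiemannianMetric E) (p x y : E) : E :=
  (g.flat p).symm ((1 / 2 : ℝ) • (fderiv ℝ g.val p x y + fderiv ℝ g.val p y x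
    - ((fderiv ℝ g.val p).flip x).flip y))

/-- The Levi-Civita connection, acting on vector fields: `∇_X Y = D_X Y + Γ(X, Y)`. -/
def nabla (g : PseudoRiemannianMetric E) (X Y : E → E) (p : E) : E :=
  fderiv ℝ Y p (X p) + g.christoffel p (X p) (Y p)

/-- The curvature of the Levi-Civita connection on vector fields:
`R(X, Y) Z = ∇_X ∇_Y Z - ∇_Y ∇_X Z - ∇_{[X, Y]} Z`. -/
def curvatureField (g : PseudoRiemannianMetric E) (X Y Z : E → E) (p : E) : E :=
  g.nabla X (g.nabla Y Z) p - g.nabla Y (g.nabla X Z) p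
    - g.nabla (VectorField.lieBracket ℝ X Y) Z p

lemma christoffel_spec (g : PseudoRiemannianMetric E) (p x y z : E) :
    g.val p (g.christoffel p x y) z = (1 / 2 : ℝ) *
      (fderiv ℝ g.val p x y z + fderiv ℝ g.val p y x z - fderiv ℝ g.val p z x y) := by
  simp [christoffel, val_flat_symm]

/-- The connection is torsion free. -/
lemma nabla_torsionFree (g : PseudoRiemannianMetric E) (X Y : E → E) (p : E) :
    g.nabla X Y p - g.nabla Y X p = VectorField.lieBracket ℝ X Y p := by
  have h : g.christoffel p (X p) (Y p) = g.christoffel p (Y p) (X p) := by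
    apply sub_eq_zero.1
    refine g.nondegenerate p _ fun z => ?_
    rw [map_sub, sub_apply, christoffel_spec, christoffel_spec,
      g.fderiv_val_symm p z (X p)]
    ring
  simp only [nabla, VectorField.lieBracket, h]
  abel

/-- The connection is compatible with the metric: `X g(Y, Z) = g(∇_X Y, Z) + g(Y, ∇_X Z)`. -/
lemma nabla_metric (g : PseudoRiemannianMetric E) (X Y Z : E → E) (p : E)
    (hY : DifferentiableAt ℝ Y p) (hZ : DifferentiableAt ℝ Z p) :
    fderiv ℝ (fun q => g.val q (Y q) (Z q)) p (X p) =
      g.val p (g.nabla X Y p) (Z p) + g.val p (Y p) (g.nabla X Z p) := by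
  have hd : DifferentiableAt ℝ g.val p := (g.smooth.differentiable (by simp)) p
  have h := ((hd.hasFDerivAt.clm_apply hY.hasFDerivAt).clm_apply hZ.hasFDerivAt).fderiv
  rw [h]
  simp only [nabla, map_add, add_apply, ContinuousLinearMap.comp_apply,
    ContinuousLinearMap.flip_apply]
  rw [g.symm p (Y p) (g.christoffel p (X p) (Z p)), christoffel_spec, christoffel_spec,
    g.fderiv_val_symm p (X p) (Z p) (Y p)]
  ring

lemma christoffel_add_right (g : PseudoRiemannianMetric E) (p x y z : E) :
    g.christoffel p x (y + z) = g.christoffel p x y + g.christoffel p x z := by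
  simp only [christoffel, ← map_add, ← smul_add]
  congr 2
  ext w
  simp
  ring

lemma christoffel_smul_right (g : PseudoRiemannianMetric E) (p x : E) (c : ℝ) (y : E) :
    g.christoffel p x (c • y) = c • g.christoffel p x y := by
  simp only [christoffel, ← map_smul]
  congr 1
  ext w
  simp
  ring

set_option maxSynthPendingDepth 3 in
lemma christoffel_differentiable (g : PseudoRiemannianMetric E) (x y : E) :
    Differentiable ℝ (fun p => g.christoffel p x y) := by
  intro p
  have hd : ContDiff ℝ ∞ (fun q => fderiv ℝ g.val q) := g.smooth.fderiv_right (by simp)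
  have hD : DifferentiableAt ℝ (fun q => fderiv ℝ g.val q) p := (hd.differentiable (by simp)) p
  have hinv : DifferentiableAt ℝ
      (fun q => ContinuousLinearMap.inverse (g.val q)) p := by
    have h1 : DifferentiableAt ℝ (ContinuousLinearMap.inverse :
        (E →L[ℝ] (E →L[ℝ] ℝ)) → _) (g.val p) :=
      (contDiffAt_map_inverse (n := 1) (g.flat p)).differentiableAt (by simp)
    exact h1.comp p ((g.smooth.differentiable (by simp)) p)
  have heq : (fun q => g.christoffel q x y) = fun q =>
      ContinuousLinearMap.inverse (g.val q) ((1 / 2 : ℝ) •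
        (fderiv ℝ g.val q x y + fderiv ℝ g.val q y x
          - ((fderiv ℝ g.val q).flip x).flip y)) := by
    funext q
    have : g.val q = (g.flat q : E →L[ℝ] (E →L[ℝ] ℝ)) := rfl
    rw [this, ContinuousLinearMap.inverse_equiv]
    rfl
  rw [heq]
  have hf : DifferentiableAt ℝ (fun q => ((fderiv ℝ g.val q).flip x).flip y) p := by
    have h2 : DifferentiableAt ℝ (fun q => (fderiv ℝ g.val q).flip) p :=
      ((ContinuousLinearMap.flipₗᵢ ℝ E E (E →L[ℝ] ℝ)).toContinuousLinearEquiv.differentiableAt).comp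
        p hD
    have h3 : DifferentiableAt ℝ (fun q => (fderiv ℝ g.val q).flip x) p :=
      h2.clm_apply (differentiableAt_const x)
    have h4 : DifferentiableAt ℝ (fun q => ((fderiv ℝ g.val q).flip x).flip) p :=
      ((ContinuousLinearMap.flipₗᵢ ℝ E E ℝ).toContinuousLinearEquiv.differentiableAt).comp p h3
    exact h4.clm_apply (differentiableAt_const y)
  have hs : DifferentiableAt ℝ (fun q => (1 / 2 : ℝ) • (fderiv ℝ g.val q x y
      + fderiv ℝ g.val q y x - ((fderiv ℝ g.val q).flip x).flip y)) p :=
    ((((hD.clm_apply (differentiableAt_const x)).clm_apply (differentiableAt_const y)).add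
      ((hD.clm_apply (differentiableAt_const y)).clm_apply (differentiableAt_const x))).sub
        hf).const_smul (1 / 2 : ℝ)
  exact hinv.clm_apply hs

lemma curvatureField_const (g : PseudoRiemannianMetric E) (p x y z : E) :
    g.curvatureField (fun _ => x) (fun _ => y) (fun _ => z) p =
      (fderiv ℝ (fun q => g.christoffel q y z) p x + g.christoffel p x (g.christoffel p y z))
      - (fderiv ℝ (fun q => g.christoffel q x z) p y
        + g.christoffel p y (g.christoffel p x z)) := by
  have h0 : g.christoffel p 0 z = 0 := by
    simp only [christoffel]
    rw [← map_zero (g.flat p).symm]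
    congr 1
    ext w
    simp
  have hn : ∀ a, g.nabla (fun _ => a) (fun _ => z) = fun q => g.christoffel q a z := by
    intro a
    funext q
    simp [nabla]
  have hl : VectorField.lieBracket ℝ (fun _ : E => x) (fun _ => y) = fun _ => 0 := by
    funext q
    simp [VectorField.lieBracket]
  rw [curvatureField, hn, hn, hl, hn]
  simp [nabla, h0]

/-- The curvature operator `R_p(x, y) : z ↦ R(x, y) z` on the tangent space at `p`; since the
curvature is a tensor, it may be computed by extending `x, y, z` to coordinate vector fields. -/
def curvature (g : PseudoRiemannianMetric E) (p x y : E) : Module.End ℝ E where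
  toFun z := g.curvatureField (fun _ => x) (fun _ => y) (fun _ => z) p
  map_add' z w := by
    simp only [curvatureField_const, christoffel_add_right]
    rw [fderiv_fun_add (g.christoffel_differentiable _ _ p) (g.christoffel_differentiable _ _ p),
      fderiv_fun_add (g.christoffel_differentiable _ _ p) (g.christoffel_differentiable _ _ p)]
    simp only [add_apply]
    abel
  map_smul' c z := by
    simp only [curvatureField_const, christoffel_smul_right, RingHom.id_apply]
    rw [fderiv_fun_const_smul (g.christoffel_differentiable _ _ p),
      fderiv_fun_const_smul (g.christoffel_differentiable _ _ p)]
    simp only [smul_apply, smul_sub, smul_add]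

/-- Spacelike Jordan Ivanov-Petrova: every tangent space is. -/
def IsSpacelikeJordanIvanovPetrova (g : PseudoRiemannianMetric E) : Prop :=
  ∀ p, IsJordanIvanovPetrova (g.form p) (g.curvature p) 1

/-- Timelike Jordan Ivanov-Petrova: every tangent space is. -/
def IsTimelikeJordanIvanovPetrova (g : PseudoRiemannianMetric E) : Prop :=
  ∀ p, IsJordanIvanovPetrova (g.form p) (g.curvature p) (-1)

/-- Every tangent space has constant spacelike rank `r`. -/
def HasSpacelikeRank (g : PseudoRiemannianMetric E) (r : ℕ) : Prop :=
  ∀ p, HasConstantSkewRank (g.form p) (g.curvature p) 1 r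

/-- `k`-spacelike Jordan Stanilov: every tangent space is. -/
def IsSpacelikeJordanStanilov (g : PseudoRiemannianMetric E) (k : ℕ) : Prop :=
  ∀ p, IsJordanStanilov (g.form p) (g.curvature p) 1 k

/-- `k`-timelike Jordan Stanilov: every tangent space is. -/
def IsTimelikeJordanStanilov (g : PseudoRiemannianMetric E) (k : ℕ) : Prop :=
  ∀ p, IsJordanStanilov (g.form p) (g.curvature p) (-1) k

end PseudoRiemannianMetric

/-! ### The metrics `g_{3s}` -/

/-- The space `ℝ^{3s}` with its coordinates `(u, t, v)`. -/
abbrev Coord (s : ℕ) : Type := (Fin s → ℝ) × (Fin s → ℝ) × (Fin s → ℝ)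

/-- The inner product `g_{3s}` at the point `p = (u, t, v)`, on tangent vectors
`x = ∑ x_i^u ∂_i^u + x_i^t ∂_i^t + x_i^v ∂_i^v`, written as `x = (x^u, x^t, x^v)`. -/
def g3sForm (s : ℕ) (p : Coord s) : Coord s →ₗ[ℝ] Coord s →ₗ[ℝ] ℝ :=
  LinearMap.mk₂ ℝ
    (fun x y => (-2 * ∑ k, p.1 k * p.2.1 k) * (∑ i, x.1 i * y.1 i)
      + ∑ i, (x.1 i * y.2.2 i + x.2.2 i * y.1 i) - ∑ i, x.2.1 i * y.2.1 i)
    (by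
      intro x x' y
      simp only [Prod.fst_add, Prod.snd_add, Pi.add_apply, add_mul, Finset.sum_add_distrib]
      ring)
    (by
      intro c x y
      simp only [Prod.smul_fst, Prod.smul_snd, Pi.smul_apply, smul_eq_mul, mul_assoc,
        Finset.sum_add_distrib, ← Finset.mul_sum]
      ring)
    (by
      intro x y y'
      simp only [Prod.fst_add, Prod.snd_add, Pi.add_apply, mul_add, Finset.sum_add_distrib]
      ring)
    (by
      intro c x y
      simp only [Prod.smul_fst, Prod.smul_snd, Pi.smul_apply, smul_eq_mul, mul_left_comm _ c,
        Finset.sum_add_distrib, ← Finset.mul_sum]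
      ring)

lemma g3sForm_apply (s : ℕ) (p x y : Coord s) : g3sForm s p x y =
    (-2 * ∑ k, p.1 k * p.2.1 k) * (∑ i, x.1 i * y.1 i)
      + ∑ i, (x.1 i * y.2.2 i + x.2.2 i * y.1 i) - ∑ i, x.2.1 i * y.2.1 i := rfl

/-- The pseudo-Riemannian metric `g_{3s}` on `ℝ^{3s}`. -/
def g3s (s : ℕ) : PseudoRiemannianMetric (Coord s) where
  val p := (g3sForm s p).toContinuousBilinearMap
  smooth := by
    rw [contDiff_clm_apply_iff]
    intro x
    rw [contDiff_clm_apply_iff]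
    intro y
    simp only [LinearMap.toContinuousBilinearMap_apply, g3sForm_apply]
    fun_prop
  symm p x y := by
    simp only [LinearMap.toContinuousBilinearMap_apply, g3sForm_apply, Finset.sum_add_distrib]
    simp only [mul_comm (y.1 _), mul_comm (y.2.1 _), mul_comm (y.2.2 _)]
    ring
  nondegenerate p x hx := by
    simp only [LinearMap.toContinuousBilinearMap_apply, g3sForm_apply] at hx
    have h1 : x.1 = 0 := by
      funext i
      simpa [Pi.single_apply] using hx (0, 0, Pi.single i 1)
    have h2 : x.2.1 = 0 := by
      funext i
      simpa [Pi.single_apply] using hx (0, Pi.single i 1, 0)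
    have h3 : x.2.2 = 0 := by
      funext i
      simpa [Pi.single_apply, h1] using hx (Pi.single i 1, 0, 0)
    exact Prod.ext h1 (Prod.ext h2 h3)

end

/-!
The Christoffel symbols of `g_{3s}` are linear in the base point (`g3s_christoffel`), so the
curvature operator can be written down (`g3s_curvature_apply`): with `S = x^u ∧ y^u`, a skew
endomorphism of `ℝ^s`,
`R(x, y) (u, t, v) = (0, -S u, S t + Q u)`,
where `Q` is a sum of wedges, each having `x^u` or `y^u` as a factor. Hence `R(x, y)` is nilpotent,
`R(x, y)² (u, t, v) = (0, 0, -S² u)`, and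
`Θ (u, t, v) = (0, 0, -∑ (e_i^u ∧ e_j^u)² u)`.
As wedges are skew, the kernel of the sum of squares is the intersection of the kernels of the
`e_i^u ∧ e_j^u`, which is the orthogonal complement of the span of the `e_i^u` as soon as this span
has dimension at least `2` (`finrank_range_wedgeSq`). Since `Θ² = 0`, its conjugacy class is
determined by its rank (`isConj_of_sq_eq_zero`), that is, by the dimension of the projection of the
plane to the `u`-space.

On the kernel `{(0, t, v)}` of that projection the metric is `-|t|²`. A spacelike `k`-plane
therefore projects injectively (`finrank_span_fst_spacelike`), and a timelike `2s`-plane, which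
meets this kernel in dimension at most `s`, projects onto `ℝ^s`
(`finrank_span_fst_maximal_timelike`). For `k < 2s` there are timelike `k`-planes with projections
of different dimensions (`eq_of_isJordanStanilov_timelike`).

On a `2`-plane `Θ = 2 R(e₁, e₂)²`. On a spacelike one `R(e₁, e₂)²` thus has rank `2`, while
`R(e₁, e₂)` has rank at most `4` (`finrank_range_g3s_curvature_le`) and cube zero; this forces two
Jordan blocks of size `3`, all others having size `1` (`isConj_of_cube_eq_zero`). On the timelike
side, the Ivanov-Petrova condition would imply the Stanilov condition for `k = 2 < 2s`
(`IsJordanIvanovPetrova.isJordanStanilov_two`).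
-/

noncomputable section

open Module (finrank)

/-! ### Conjugacy of nilpotent endomorphisms with few block sizes -/

section Nilpotent

variable {K V : Type*} [Field K] [AddCommGroup V] [Module K V]

lemma isConj_of_linearEquiv {A A' : Module.End K V} (e : V ≃ₗ[K] V)
    (h : ∀ x, e (A x) = A' (e x)) : IsConj A A' :=
  ⟨LinearMap.GeneralLinearGroup.ofLinearEquiv e, LinearMap.ext h⟩

lemma finrank_range_eq_of_isConj {A A' : Module.End K V} (h : IsConj A A') :
    finrank K (LinearMap.range A) = finrank K (LinearMap.range A') := by
  obtain ⟨c, hc⟩ := h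
  let e := LinearMap.GeneralLinearGroup.toLinearEquiv c
  have he : (e : V →ₗ[K] V) ∘ₗ A = A' ∘ₗ (e : V →ₗ[K] V) := hc
  have h1 := LinearMap.range_comp A (e : V →ₗ[K] V)
  have h2 := LinearMap.range_comp_of_range_eq_top A' (LinearEquiv.range e)
  rw [← h2, ← he, h1]
  exact (LinearEquiv.finrank_map_eq e _).symm

lemma exists_sup_eq_and_disjoint {U L : Submodule K V} (h : U ≤ L) :
    ∃ C, U ⊔ C = L ∧ Disjoint U C := by
  obtain ⟨D, hD⟩ := U.exists_isCompl
  refine ⟨D ⊓ L, ?_, hD.disjoint.mono_right inf_le_left⟩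
  rw [← sup_inf_assoc_of_le D h, hD.sup_eq_top, top_inf_eq]

variable [FiniteDimensional K V]

lemma finrank_complement_ker (A : Module.End K V) {W : Submodule K V}
    (hW : IsCompl W (LinearMap.ker A)) : finrank K W = finrank K (LinearMap.range A) := by
  have h1 := Submodule.finrank_add_eq_of_isCompl hW
  have h2 := A.finrank_range_add_finrank_ker
  omega

/-- If `A ^ 3 = 0` then the vectors of the form `A b + A² c` give `rank A ≥ 2 rank A²`; in case of
equality all Jordan blocks have size `3` or `1`, and with a complement `W` of `ker A²` and a
complement `C` of `range A²` in `ker A` one has `V = W ⊕ A W ⊕ A² W ⊕ C`. -/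
lemma exists_equiv_of_cube_eq_zero {A : Module.End K V} (h3 : A ^ 3 = 0)
    (hr : finrank K (LinearMap.range A) ≤ 2 * finrank K (LinearMap.range (A ^ 2))) :
    finrank K (LinearMap.range A) = 2 * finrank K (LinearMap.range (A ^ 2)) ∧
    ∃ (W C : Submodule K V) (F : (W × W × W × C) ≃ₗ[K] V),
      finrank K W = finrank K (LinearMap.range (A ^ 2)) ∧
      ∀ a b c k, A (F (a, b, c, k)) = F (0, a, b, 0) := by
  have hA3 : ∀ x, A (A (A x)) = 0 := fun x => LinearMap.congr_fun h3 x
  have hA2 : ∀ x, (A ^ 2) x = A (A x) := fun x => rfl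
  obtain ⟨W, hW⟩ := (LinearMap.ker (A ^ 2)).exists_isCompl
  have hWr := finrank_complement_ker _ hW.symm
  have hle : LinearMap.range (A ^ 2) ≤ LinearMap.ker A := by
    rintro _ ⟨x, rfl⟩
    exact hA3 x
  obtain ⟨C, hsup, hdis⟩ := exists_sup_eq_and_disjoint hle
  have hC : ∀ k ∈ C, A k = 0 := fun k hk => by
    have : k ∈ LinearMap.ker A := hsup ▸ Submodule.mem_sup_right hk
    exact this
  have hWinj : ∀ w ∈ W, A (A w) = 0 → w = 0 := fun w hw h =>
    Submodule.disjoint_def.1 hW.symm.disjoint w hw h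
  let F : (W × W × W × C) →ₗ[K] V :=
    W.subtype.coprod ((A ∘ₗ W.subtype).coprod (((A ^ 2) ∘ₗ W.subtype).coprod C.subtype))
  have hF : ∀ a b c k, F (a, b, c, k) = a + (A b + (A (A c) + k)) := fun _ _ _ _ => rfl
  have hinj : Function.Injective F := by
    rw [injective_iff_map_eq_zero]
    rintro ⟨a, b, c, k⟩ h
    rw [hF] at h
    have ha : (a : V) = 0 := hWinj a a.2 <| by
      simpa [hA3, hC k k.2] using congrArg (fun x => A (A x)) h
    have hb : (b : V) = 0 := hWinj b b.2 <| by
      simpa [hA3, hC k k.2, ha] using congrArg (fun x => A x) h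
    simp only [ha, hb, map_zero, zero_add] at h
    have hk : (k : V) = 0 := Submodule.disjoint_def.1 hdis k
      ⟨-c, by rw [map_neg, hA2]; exact (eq_neg_of_add_eq_zero_right h).symm⟩ k.2
    have hc : (c : V) = 0 := hWinj c c.2 (by simpa [hk] using h)
    simp only [ZeroMemClass.coe_eq_zero] at ha hb hc hk
    simp [ha, hb, hc, hk]
  have hdimC : finrank K (LinearMap.range (A ^ 2)) + finrank K C = finrank K (LinearMap.ker A) := by
    rw [← hsup, ← Submodule.finrank_sup_add_finrank_inf_eq, hdis.eq_bot, finrank_bot, add_zero]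
  have hrk := A.finrank_range_add_finrank_ker
  have hle' := LinearMap.finrank_le_finrank_of_injective hinj
  have hprod : finrank K (W × W × W × C) = 3 * finrank K W + finrank K C := by
    simp only [Module.finrank_prod]; ring
  have heq : finrank K (W × W × W × C) = finrank K V := by omega
  refine ⟨by omega, W, C, LinearEquiv.ofInjectiveOfFinrankEq F hinj heq, hWr, fun a b c k => ?_⟩
  change A (F (a, b, c, k)) = F (0, a, b, 0)
  simp [hF, hA3, hC k k.2]

/-- Endomorphisms with all Jordan blocks nilpotent of size `3` or `1` are classified by their
rank. -/
lemma isConj_of_cube_eq_zero {A A' : Module.End K V} (h3 : A ^ 3 = 0) (h3' : A' ^ 3 = 0)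
    (hr : finrank K (LinearMap.range A) ≤ 2 * finrank K (LinearMap.range (A ^ 2)))
    (hr' : finrank K (LinearMap.range A') ≤ 2 * finrank K (LinearMap.range (A' ^ 2)))
    (h : finrank K (LinearMap.range (A ^ 2)) = finrank K (LinearMap.range (A' ^ 2))) :
    IsConj A A' := by
  obtain ⟨-, W, C, F, hW, hF⟩ := exists_equiv_of_cube_eq_zero h3 hr
  obtain ⟨-, W', C', F', hW', hF'⟩ := exists_equiv_of_cube_eq_zero h3' hr'
  have h1 := F.finrank_eq
  have h2 := F'.finrank_eq
  simp only [Module.finrank_prod] at h1 h2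
  let eW : W ≃ₗ[K] W' := LinearEquiv.ofFinrankEq _ _ (by omega)
  let eC : C ≃ₗ[K] C' := LinearEquiv.ofFinrankEq _ _ (by omega)
  refine isConj_of_linearEquiv
    (F.symm ≪≫ₗ (eW.prodCongr (eW.prodCongr (eW.prodCongr eC))) ≪≫ₗ F') fun x => ?_
  obtain ⟨⟨a, b, c, k⟩, rfl⟩ := F.surjective x
  simp [hF, hF']

/-- Endomorphisms of square zero are classified by their rank. -/
lemma isConj_of_sq_eq_zero {A A' : Module.End K V} (h2 : A ^ 2 = 0) (h2' : A' ^ 2 = 0)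
    (h : finrank K (LinearMap.range A) = finrank K (LinearMap.range A')) : IsConj A A' := by
  -- the normal form `V = W ⊕ A W ⊕ C`, where `W` is a complement of `ker A` and `C` one of
  -- `range A` in `ker A`
  have key : ∀ B : Module.End K V, B ^ 2 = 0 → ∃ (W C : Submodule K V) (F : (W × W × C) ≃ₗ[K] V),
      finrank K W = finrank K (LinearMap.range B) ∧ ∀ a b k, B (F (a, b, k)) = F (0, a, 0) := by
    intro B hB
    have hB2 : ∀ x, B (B x) = 0 := fun x => LinearMap.congr_fun hB x
    obtain ⟨W, hW⟩ := (LinearMap.ker B).exists_isCompl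
    have hWr := finrank_complement_ker _ hW.symm
    have hle : LinearMap.range B ≤ LinearMap.ker B := by
      rintro _ ⟨x, rfl⟩
      exact hB2 x
    obtain ⟨C, hsup, hdis⟩ := exists_sup_eq_and_disjoint hle
    have hC : ∀ k ∈ C, B k = 0 := fun k hk => by
      have : k ∈ LinearMap.ker B := hsup ▸ Submodule.mem_sup_right hk
      exact this
    have hWinj : ∀ w ∈ W, B w = 0 → w = 0 := fun w hw h =>
      Submodule.disjoint_def.1 hW.symm.disjoint w hw h
    let F : (W × W × C) →ₗ[K] V := W.subtype.coprod ((B ∘ₗ W.subtype).coprod C.subtype)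
    have hF : ∀ a b k, F (a, b, k) = a + (B b + k) := fun _ _ _ => rfl
    have hinj : Function.Injective F := by
      rw [injective_iff_map_eq_zero]
      rintro ⟨a, b, k⟩ h
      rw [hF] at h
      have ha : (a : V) = 0 := hWinj a a.2 <| by
        simpa [hB2, hC k k.2] using congrArg (fun x => B x) h
      simp only [ha, zero_add] at h
      have hk : (k : V) = 0 := Submodule.disjoint_def.1 hdis k
        ⟨-b, by rw [map_neg]; exact (eq_neg_of_add_eq_zero_right h).symm⟩ k.2
      have hb : (b : V) = 0 := hWinj b b.2 (by simpa [hk] using h)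
      simp only [ZeroMemClass.coe_eq_zero] at ha hb hk
      simp [ha, hb, hk]
    have hdimC : finrank K (LinearMap.range B) + finrank K C = finrank K (LinearMap.ker B) := by
      rw [← hsup, ← Submodule.finrank_sup_add_finrank_inf_eq, hdis.eq_bot, finrank_bot, add_zero]
    have hrk := B.finrank_range_add_finrank_ker
    have heq : finrank K (W × W × C) = finrank K V := by
      simp only [Module.finrank_prod]; omega
    refine ⟨W, C, LinearEquiv.ofInjectiveOfFinrankEq F hinj heq, hWr, fun a b k => ?_⟩
    change B (F (a, b, k)) = F (0, a, 0)
    simp [hF, hB2, hC k k.2]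
  obtain ⟨W, C, F, hW, hF⟩ := key A h2
  obtain ⟨W', C', F', hW', hF'⟩ := key A' h2'
  have h1 := F.finrank_eq
  have h2 := F'.finrank_eq
  simp only [Module.finrank_prod] at h1 h2
  let eW : W ≃ₗ[K] W' := LinearEquiv.ofFinrankEq _ _ (by omega)
  let eC : C ≃ₗ[K] C' := LinearEquiv.ofFinrankEq _ _ (by omega)
  refine isConj_of_linearEquiv (F.symm ≪≫ₗ (eW.prodCongr (eW.prodCongr eC)) ≪≫ₗ F') fun x => ?_
  obtain ⟨⟨a, b, k⟩, rfl⟩ := F.surjective x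
  simp [hF, hF']

end Nilpotent

/-! ### Sums of squares of wedges `a i ∧ a j` -/

section Wedge

variable {ι : Type*} [Fintype ι]

lemma dotProduct_self_nonneg_real (v : ι → ℝ) : 0 ≤ v ⬝ᵥ v :=
  Finset.sum_nonneg fun _ _ => mul_self_nonneg _

/-- The skew endomorphism `a ∧ b : w ↦ ⟨b, w⟩ a - ⟨a, w⟩ b` of the Euclidean space `ℝ^ι`. -/
def wedge (a b : ι → ℝ) : Module.End ℝ (ι → ℝ) where
  toFun w := (b ⬝ᵥ w) • a - (a ⬝ᵥ w) • b
  map_add' w w' := by simp only [dotProduct_add, add_smul]; abel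
  map_smul' c w := by simp only [dotProduct_smul, smul_sub, smul_smul, smul_eq_mul, RingHom.id_apply]

lemma wedge_apply (a b w : ι → ℝ) : wedge a b w = (b ⬝ᵥ w) • a - (a ⬝ᵥ w) • b := rfl

lemma dotProduct_wedge (a b w w' : ι → ℝ) : w' ⬝ᵥ wedge a b w = -(wedge a b w' ⬝ᵥ w) := by
  simp only [wedge_apply, dotProduct_sub, sub_dotProduct, dotProduct_smul, smul_dotProduct,
    smul_eq_mul, dotProduct_comm w' a, dotProduct_comm w' b]
  ring

/-- The sum of the squares of all `a i ∧ a j`. -/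
def wedgeSq {k : ℕ} (a : Fin k → ι → ℝ) : Module.End ℝ (ι → ℝ) :=
  ∑ i, ∑ j, wedge (a i) (a j) * wedge (a i) (a j)

lemma wedgeSq_apply {k : ℕ} (a : Fin k → ι → ℝ) (w : ι → ℝ) :
    wedgeSq a w = ∑ i, ∑ j, wedge (a i) (a j) (wedge (a i) (a j) w) := by
  simp [wedgeSq]

/-- Each `a i ∧ a j` is skew, so `⟨w, wedgeSq a w⟩ = -∑ |(a i ∧ a j) w|²`. -/
lemma wedge_eq_zero_of_wedgeSq {k : ℕ} {a : Fin k → ι → ℝ} {w : ι → ℝ} (h : wedgeSq a w = 0)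
    (i j : Fin k) : wedge (a i) (a j) w = 0 := by
  have h0 : ∑ i, ∑ j, wedge (a i) (a j) w ⬝ᵥ wedge (a i) (a j) w = 0 := by
    have := congrArg (fun z => -(w ⬝ᵥ z)) h
    simpa [wedgeSq_apply, dotProduct_sum, dotProduct_wedge _ _ _ w] using this
  have hnn := dotProduct_self_nonneg_real (ι := ι)
  rw [Finset.sum_eq_zero_iff_of_nonneg fun i _ => Finset.sum_nonneg fun j _ => hnn _] at h0
  have h1 := h0 i (Finset.mem_univ i)
  rw [Finset.sum_eq_zero_iff_of_nonneg fun j _ => hnn _] at h1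
  exact dotProduct_self_eq_zero.1 (h1 j (Finset.mem_univ j))

lemma wedgeSq_eq_zero_of_orthogonal {k : ℕ} {a : Fin k → ι → ℝ} {w : ι → ℝ}
    (h : ∀ i, a i ⬝ᵥ w = 0) : wedgeSq a w = 0 := by
  simp [wedgeSq_apply, wedge_apply, h]

/-- If all `a i ∧ a j` vanish on a vector not orthogonal to some `a i`, then all `a j` are
multiples of `a i`. -/
lemma orthogonal_of_wedgeSq_eq_zero {k : ℕ} {a : Fin k → ι → ℝ} {w : ι → ℝ}
    (hk : 2 ≤ finrank ℝ (Submodule.span ℝ (Set.range a))) (h : wedgeSq a w = 0) (i : Fin k) :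
    a i ⬝ᵥ w = 0 := by
  by_contra hi
  have hle : Submodule.span ℝ (Set.range a) ≤ Submodule.span ℝ {a i} := by
    rw [Submodule.span_le]
    rintro _ ⟨j, rfl⟩
    refine Submodule.mem_span_singleton.2 ⟨(a i ⬝ᵥ w)⁻¹ * (a j ⬝ᵥ w), ?_⟩
    have := sub_eq_zero.1 (wedge_eq_zero_of_wedgeSq h i j)
    rw [mul_smul, this, smul_smul, inv_mul_cancel₀ hi, one_smul]
  have h1 := Submodule.finrank_mono hle
  have h2 := finrank_span_le_card (R := ℝ) ({a i} : Set (ι → ℝ))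
  simp at h2
  omega

lemma finrank_ker_add_finrank_span (k : ℕ) (a : Fin k → ι → ℝ) :
    finrank ℝ (LinearMap.ker (Matrix.of a).mulVecLin) +
      finrank ℝ (Submodule.span ℝ (Set.range a)) = Fintype.card ι := by
  have h1 := (Matrix.of a).mulVecLin.finrank_range_add_finrank_ker
  have h2 := (Matrix.of a).rank_eq_finrank_span_row
  simp only [Matrix.rank, Module.finrank_fintype_fun_eq_card] at h1 h2
  have h3 : Set.range (Matrix.of a).row = Set.range a := rfl
  rw [h3] at h2
  omega

lemma finrank_range_wedgeSq_le {k : ℕ} (a : Fin k → ι → ℝ) :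
    finrank ℝ (LinearMap.range (wedgeSq a)) ≤ finrank ℝ (Submodule.span ℝ (Set.range a)) := by
  have hle : LinearMap.ker (Matrix.of a).mulVecLin ≤ LinearMap.ker (wedgeSq a) := fun w hw =>
    wedgeSq_eq_zero_of_orthogonal fun i => congrFun (show (Matrix.of a).mulVecLin w = 0 from hw) i
  have h1 := Submodule.finrank_mono hle
  have h2 := finrank_ker_add_finrank_span k a
  have h3 := (wedgeSq a).finrank_range_add_finrank_ker
  rw [Module.finrank_fintype_fun_eq_card] at h3
  omega

lemma finrank_range_wedgeSq {k : ℕ} (a : Fin k → ι → ℝ)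
    (hk : 2 ≤ finrank ℝ (Submodule.span ℝ (Set.range a))) :
    finrank ℝ (LinearMap.range (wedgeSq a)) = finrank ℝ (Submodule.span ℝ (Set.range a)) := by
  have hle : LinearMap.ker (wedgeSq a) ≤ LinearMap.ker (Matrix.of a).mulVecLin := fun w hw =>
    show (Matrix.of a).mulVecLin w = 0 from funext fun i => orthogonal_of_wedgeSq_eq_zero hk hw i
  have h1 := Submodule.finrank_mono hle
  have h2 := finrank_ker_add_finrank_span k a
  have h3 := (wedgeSq a).finrank_range_add_finrank_ker
  have h4 := finrank_range_wedgeSq_le a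
  rw [Module.finrank_fintype_fun_eq_card] at h3
  omega

end Wedge

/-! ### Curvature operators of definite planes -/

section Planes

variable {V : Type*} [AddCommGroup V] [Module ℝ V] {B : LinearMap.BilinForm ℝ V}
  {R : V → V → Module.End ℝ V}

lemma sum_sq_eq_two_smul_sq (hR : ∀ x y, R x y = -R y x) (f : Fin 2 → V) :
    ∑ i, ∑ j, R (f i) (f j) * R (f i) (f j) = (2 : ℝ) • R (f 0) (f 1) ^ 2 := by
  have h0 : ∀ x, R x x = 0 := fun x => by
    have h2 : (2 : ℝ) • R x x = 0 := by rw [two_smul]; nth_rw 2 [hR x x]; exact add_neg_cancel _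
    simpa using h2
  simp only [Fin.sum_univ_two, h0, hR (f 1) (f 0), neg_mul_neg, two_smul, sq]
  simp

/-- On a `2`-plane the higher order curvature operator is twice the square of the skew-symmetric
curvature operator. -/
lemma IsJordanIvanovPetrova.isJordanStanilov_two {ε : ℝ} (hR : ∀ x y, R x y = -R y x)
    (h : IsJordanIvanovPetrova B R ε) : IsJordanStanilov B R ε 2 := by
  rintro P P' A A' ⟨e, he, rfl⟩ ⟨e', he', rfl⟩
  obtain ⟨c, hc⟩ := h ⟨P, e.orientation⟩ ⟨P', e'.orientation⟩ _ _ ⟨e, he, rfl, rfl⟩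
    ⟨e', he', rfl, rfl⟩
  rw [sum_sq_eq_two_smul_sq hR fun i => (e i : V), sum_sq_eq_two_smul_sq hR fun i => (e' i : V)]
  refine ⟨c, ?_⟩
  have := hc.pow_right 2
  rw [SemiconjBy] at this ⊢
  rw [mul_smul_comm, this, smul_mul_assoc]

/-- An orthonormal family spans a definite plane, of which it is an orthonormal basis. -/
lemma exists_timelike_plane {k : ℕ} {f : Fin k → V}
    (hf : ∀ i j, B (f i) (f j) = if i = j then -1 else 0) :
    ∃ (P : DefinitePlane B (-1) k) (e : Module.Basis (Fin k) ℝ P.carrier),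
      IsOrthonormalBasis B (-1) e ∧ ∀ i, (e i : V) = f i := by
  have hcomb : ∀ (c : Fin k → ℝ), B (∑ i, c i • f i) (∑ i, c i • f i) = -∑ i, c i * c i := by
    intro c
    simp [map_sum, LinearMap.sum_apply, hf]
  have hli : LinearIndependent ℝ f := by
    rw [Fintype.linearIndependent_iff]
    intro c hc i
    have h1 := congrArg (B (f i)) hc
    simpa [hf] using h1
  have hcoe : ∀ i, (Module.Basis.span hli i : V) = f i := fun i =>
    congrArg Subtype.val (Module.Basis.span_apply hli i)
  refine ⟨⟨Submodule.span ℝ (Set.range f), ?_, ?_⟩, Module.Basis.span hli, ?_, hcoe⟩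
  · rw [finrank_span_eq_card hli, Fintype.card_fin]
  · intro x hx hx0
    obtain ⟨c, rfl⟩ := (Submodule.mem_span_range_iff_exists_fun ℝ).1 hx
    rw [hcomb, neg_one_mul, neg_neg]
    refine (Finset.sum_nonneg fun i _ => mul_self_nonneg (c i)).lt_of_ne' fun h => hx0 ?_
    rw [Finset.sum_eq_zero_iff_of_nonneg fun i _ => mul_self_nonneg (c i)] at h
    exact Finset.sum_eq_zero fun i hi => by rw [mul_self_eq_zero.1 (h i hi), zero_smul]
  · intro i j
    rw [hcoe, hcoe, hf]

end Planes

/-! ### The curvature of `g_{3s}` -/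

section Geometry

variable {s : ℕ}

lemma g3s_val_apply (p x y : Coord s) : (g3s s).val p x y =
    -2 * (p.1 ⬝ᵥ p.2.1) * (x.1 ⬝ᵥ y.1) + (x.1 ⬝ᵥ y.2.2 + x.2.2 ⬝ᵥ y.1) - x.2.1 ⬝ᵥ y.2.1 := by
  change g3sForm s p x y = _
  simp only [g3sForm_apply, dotProduct, Finset.sum_add_distrib]

lemma g3s_form_apply (p x y : Coord s) : (g3s s).form p x y =
    -2 * (p.1 ⬝ᵥ p.2.1) * (x.1 ⬝ᵥ y.1) + (x.1 ⬝ᵥ y.2.2 + x.2.2 ⬝ᵥ y.1) - x.2.1 ⬝ᵥ y.2.1 :=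
  g3s_val_apply p x y

lemma fderiv_g3s_val (p x y z : Coord s) : fderiv ℝ (g3s s).val p x y z =
    -2 * (x.1 ⬝ᵥ p.2.1 + p.1 ⬝ᵥ x.2.1) * (y.1 ⬝ᵥ z.1) := by
  have hd : DifferentiableAt ℝ (g3s s).val p := ((g3s s).smooth.differentiable (by simp)) p
  have h1 := ((hd.hasFDerivAt.clm_apply (hasFDerivAt_const y p)).clm_apply
    (hasFDerivAt_const z p))
  let U (i : Fin s) : Coord s →L[ℝ] ℝ :=
    (ContinuousLinearMap.proj i).comp (ContinuousLinearMap.fst ℝ _ _)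
  let T (i : Fin s) : Coord s →L[ℝ] ℝ := (ContinuousLinearMap.proj i).comp
    ((ContinuousLinearMap.fst ℝ _ _).comp (ContinuousLinearMap.snd ℝ _ _))
  have hU : ∀ i (q : Coord s), U i q = q.1 i := fun _ _ => rfl
  have hT : ∀ i (q : Coord s), T i q = q.2.1 i := fun _ _ => rfl
  have h2 : HasFDerivAt (fun q : Coord s => q.1 ⬝ᵥ q.2.1)
      (∑ i, (p.1 i • T i + p.2.1 i • U i)) p :=
    HasFDerivAt.fun_sum fun i _ => (U i).hasFDerivAt.mul (T i).hasFDerivAt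
  have h3 := (((h2.const_mul (-2)).mul_const (y.1 ⬝ᵥ z.1)).add_const
    (y.1 ⬝ᵥ z.2.2 + y.2.2 ⬝ᵥ z.1)).sub_const (y.2.1 ⬝ᵥ z.2.1)
  have h4 : (fun q => (g3s s).val q y z) = fun q =>
    -2 * (q.1 ⬝ᵥ q.2.1) * (y.1 ⬝ᵥ z.1) + (y.1 ⬝ᵥ z.2.2 + y.2.2 ⬝ᵥ z.1) - y.2.1 ⬝ᵥ z.2.1 :=
    funext fun q => g3s_val_apply q y z
  rw [h4] at h1
  have h5 := congrArg (fun L : Coord s →L[ℝ] ℝ => L x) (h1.unique h3)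
  simp only [zero_apply, add_apply, ContinuousLinearMap.comp_apply, smul_apply, sum_apply,
    ContinuousLinearMap.flip_apply, map_zero, zero_add, smul_eq_mul, hU, hT,
    Finset.sum_add_distrib] at h5
  simp only [dotProduct] at h5 ⊢
  simp only [mul_comm (x.1 _)]
  rw [h5]
  ring

/-- The Christoffel symbols of `g_{3s}` are linear in the base point. -/
lemma g3s_christoffel (p x y : Coord s) : (g3s s).christoffel p x y =
    (0, -(x.1 ⬝ᵥ y.1) • p.1,
      (x.1 ⬝ᵥ y.1) • p.2.1 - (x.1 ⬝ᵥ p.2.1 + p.1 ⬝ᵥ x.2.1) • y.1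
        - (y.1 ⬝ᵥ p.2.1 + p.1 ⬝ᵥ y.2.1) • x.1) := by
  refine sub_eq_zero.1 ((g3s s).nondegenerate p _ fun z => ?_)
  rw [map_sub, sub_apply, (g3s s).christoffel_spec, fderiv_g3s_val, fderiv_g3s_val,
    fderiv_g3s_val, g3s_val_apply]
  simp only [zero_dotProduct, sub_dotProduct, smul_dotProduct, smul_eq_mul, neg_smul,
    neg_dotProduct, dotProduct_comm p.2.1 z.1]
  ring

lemma fderiv_g3s_christoffel (p x y z : Coord s) :
    fderiv ℝ (fun q => (g3s s).christoffel q y z) p x = (g3s s).christoffel x y z := by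
  let L : Coord s →ₗ[ℝ] Coord s :=
    { toFun := fun q => (g3s s).christoffel q y z
      map_add' := fun q q' => by
        simp only [g3s_christoffel, Prod.fst_add, Prod.snd_add, dotProduct_add, add_dotProduct,
          Prod.mk_add_mk, Prod.mk.injEq]
        refine ⟨by simp, by module, by module⟩
      map_smul' := fun c q => by
        simp only [g3s_christoffel, Prod.smul_fst, Prod.smul_snd, dotProduct_smul,
          smul_dotProduct, Prod.smul_mk, Prod.mk.injEq, RingHom.id_apply, smul_eq_mul]
        refine ⟨by simp, by module, by module⟩ }
  exact congrArg (fun T : Coord s →L[ℝ] Coord s => T x) L.toContinuousLinearMap.fderiv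

/-- The curvature operator is strictly triangular for the flag `{(0, 0, v)} ⊆ {(0, t, v)}`; up to
sign both entries next to the diagonal are the wedge of the `u`-components of the two vectors. -/
lemma g3s_curvature_apply (p x y z : Coord s) : (g3s s).curvature p x y z =
    (0, -wedge x.1 y.1 z.1, wedge x.1 y.1 z.2.1 + (wedge x.1 y.2.1 z.1 + wedge x.2.1 y.1 z.1
      + (p.1 ⬝ᵥ p.1) • wedge x.1 y.1 z.1)) := by
  change (g3s s).curvatureField _ _ _ p = _
  rw [(g3s s).curvatureField_const, fderiv_g3s_christoffel, fderiv_g3s_christoffel]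
  simp only [g3s_christoffel, Prod.mk_add_mk, Prod.mk_sub_mk, Prod.mk.injEq, wedge_apply,
    zero_dotProduct, dotProduct_zero, dotProduct_smul, smul_eq_mul]
  refine ⟨by simp, by module, ?_⟩
  simp only [dotProduct_comm x.2.1 z.1, dotProduct_comm y.2.1 z.1, dotProduct_comm y.1 x.2.1]
  rw [dotProduct_comm x.1 y.2.1]
  module

lemma g3s_curvature_antisymm (p x y : Coord s) :
    (g3s s).curvature p x y = -(g3s s).curvature p y x := by
  refine LinearMap.ext fun z => ?_
  rw [LinearMap.neg_apply, g3s_curvature_apply, g3s_curvature_apply]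
  simp only [wedge_apply, Prod.neg_mk, Prod.mk.injEq]
  refine ⟨by simp, by module, by module⟩

lemma g3s_curvature_curvature_apply (p x y z : Coord s) :
    (g3s s).curvature p x y ((g3s s).curvature p x y z) =
      (0, 0, -wedge x.1 y.1 (wedge x.1 y.1 z.1)) := by
  rw [g3s_curvature_apply p x y z, g3s_curvature_apply]
  simp

lemma g3s_curvature_pow_three (p x y : Coord s) : (g3s s).curvature p x y ^ 3 = 0 := by
  refine LinearMap.ext fun z => ?_
  change (g3s s).curvature p x y ((g3s s).curvature p x y ((g3s s).curvature p x y z)) = 0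
  rw [g3s_curvature_curvature_apply, g3s_curvature_apply]
  simp

/-- The range of `R(x, y)` is spanned by four vectors: two come from `z ↦ ⟨x^u, z^u⟩` and
`z ↦ ⟨y^u, z^u⟩`, the other two are `(0, 0, x^u)` and `(0, 0, y^u)`. -/
lemma finrank_range_g3s_curvature_le (p x y : Coord s) :
    finrank ℝ (LinearMap.range ((g3s s).curvature p x y)) ≤ 4 := by
  let b : Fin 4 → Coord s := ![(0, -x.1, x.2.1 + (p.1 ⬝ᵥ p.1) • x.1),
    (0, y.1, -y.2.1 - (p.1 ⬝ᵥ p.1) • y.1), (0, 0, x.1), (0, 0, y.1)]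
  have hle : LinearMap.range ((g3s s).curvature p x y) ≤ Submodule.span ℝ (Set.range b) := by
    rintro _ ⟨z, rfl⟩
    refine (Submodule.mem_span_range_iff_exists_fun ℝ).2
      ⟨![y.1 ⬝ᵥ z.1, x.1 ⬝ᵥ z.1, y.1 ⬝ᵥ z.2.1 + y.2.1 ⬝ᵥ z.1,
        -(x.1 ⬝ᵥ z.2.1 + x.2.1 ⬝ᵥ z.1)], ?_⟩
    rw [g3s_curvature_apply]
    simp only [Fin.sum_univ_four, b, wedge_apply]
    refine Prod.ext ?_ (Prod.ext ?_ ?_)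
    · simp
    · simp only [Matrix.cons_val, Prod.snd_add, Prod.fst_add, Prod.smul_snd, Prod.smul_fst]
      module
    · simp only [Matrix.cons_val, Prod.snd_add, Prod.smul_snd]
      module
  exact (Submodule.finrank_mono hle).trans ((finrank_range_le_card b).trans (by simp))

/-- The higher order curvature operator of `g_{3s}` factors through the `u`-components:
`Θ z = (0, 0, -(wedgeSq z^u))`. -/
lemma sum_g3s_curvature_apply (p : Coord s) {k : ℕ} (e : Fin k → Coord s) (z : Coord s) :
    (∑ i, ∑ j, (g3s s).curvature p (e i) (e j) * (g3s s).curvature p (e i) (e j)) z =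
      (0, 0, -wedgeSq (fun i => (e i).1) z.1) := by
  have h : ∀ w : Fin s → ℝ, ((0, 0, w) : Coord s) = LinearMap.inr ℝ _ _ (LinearMap.inr ℝ _ _ w) :=
    fun _ => rfl
  simp only [LinearMap.sum_apply, Module.End.mul_apply, g3s_curvature_curvature_apply,
    wedgeSq_apply, h, ← map_sum, Finset.sum_neg_distrib]

lemma sum_g3s_curvature_sq (p : Coord s) {k : ℕ} (e : Fin k → Coord s) :
    (∑ i, ∑ j, (g3s s).curvature p (e i) (e j) * (g3s s).curvature p (e i) (e j)) ^ 2 = 0 := by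
  refine LinearMap.ext fun z => ?_
  rw [sq, Module.End.mul_apply, sum_g3s_curvature_apply, sum_g3s_curvature_apply]
  simp

lemma finrank_range_sum_g3s_curvature (p : Coord s) {k : ℕ} (e : Fin k → Coord s) :
    finrank ℝ (LinearMap.range
      (∑ i, ∑ j, (g3s s).curvature p (e i) (e j) * (g3s s).curvature p (e i) (e j))) =
      finrank ℝ (LinearMap.range (wedgeSq fun i => (e i).1)) := by
  let N : (Fin s → ℝ) →ₗ[ℝ] Coord s := LinearMap.inr ℝ _ _ ∘ₗ LinearMap.inr ℝ _ _
  have hN : Function.Injective N := LinearMap.inr_injective.comp LinearMap.inr_injective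
  have h : (∑ i, ∑ j, (g3s s).curvature p (e i) (e j) * (g3s s).curvature p (e i) (e j)) =
      N ∘ₗ ((-wedgeSq fun i => (e i).1) ∘ₗ LinearMap.fst ℝ _ _) :=
    LinearMap.ext fun z => sum_g3s_curvature_apply p e z
  rw [h, LinearMap.range_comp, LinearMap.range_comp_of_range_eq_top _ Submodule.range_fst,
    LinearMap.range_neg]
  exact (Submodule.equivMapOfInjective N hN _).finrank_eq.symm

end Geometry

/-! ### Projections of definite planes to the `u`-space -/

section DefinitePlanes

variable {s k : ℕ} {p : Coord s}

/-- The span of the `u`-components of a basis of `W` is the projection of `W`. -/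
lemma span_fst_basis {W : Submodule ℝ (Coord s)} (e : Module.Basis (Fin k) ℝ W) :
    Submodule.span ℝ (Set.range fun i => (e i : Coord s).1) =
      LinearMap.range (LinearMap.fst ℝ (Fin s → ℝ) _ ∘ₗ W.subtype) := by
  rw [LinearMap.range_eq_map, ← e.span_eq, Submodule.map_span, ← Set.range_comp]
  rfl

/-- A spacelike plane meets the kernel `{(0, t, v)}` of the `u`-projection trivially, since
`g_{3s}` is negative semidefinite there. -/
lemma finrank_span_fst_spacelike (P : DefinitePlane ((g3s s).form p) 1 k)
    (e : Module.Basis (Fin k) ℝ P.carrier) :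
    finrank ℝ (Submodule.span ℝ (Set.range fun i => (e i : Coord s).1)) = k := by
  rw [span_fst_basis, LinearMap.finrank_range_of_inj, P.finrank_eq]
  rw [injective_iff_map_eq_zero]
  intro x hx
  by_contra hne
  have h1 := P.definite x x.2 (by simpa using hne)
  have hx' : (x : Coord s).1 = 0 := hx
  have h2 := dotProduct_self_nonneg_real (x : Coord s).2.1
  simp only [g3s_form_apply, hx', zero_dotProduct, dotProduct_zero] at h1
  linarith

/-- In a maximal timelike plane the kernel of the `u`-projection injects into `ℝ^s` by the
`t`-component, because the vectors `(0, 0, v)` are null. -/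
lemma finrank_span_fst_maximal_timelike (P : DefinitePlane ((g3s s).form p) (-1) (2 * s))
    (e : Module.Basis (Fin (2 * s)) ℝ P.carrier) :
    finrank ℝ (Submodule.span ℝ (Set.range fun i => (e i : Coord s).1)) = s := by
  rw [span_fst_basis]
  set f := LinearMap.fst ℝ (Fin s → ℝ) _ ∘ₗ P.carrier.subtype with hf
  have h1 := f.finrank_range_add_finrank_ker
  rw [P.finrank_eq] at h1
  have h2 : finrank ℝ (LinearMap.range f) ≤ s := by
    simpa using (LinearMap.range f).finrank_le
  have h3 : finrank ℝ (LinearMap.ker f) ≤ s := by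
    let h : LinearMap.ker f →ₗ[ℝ] (Fin s → ℝ) := LinearMap.fst ℝ _ _ ∘ₗ LinearMap.snd ℝ _ _ ∘ₗ
      P.carrier.subtype ∘ₗ (LinearMap.ker f).subtype
    have hinj : Function.Injective h := by
      rw [injective_iff_map_eq_zero]
      intro x hx
      by_contra hne
      have h4 := P.definite x x.1.2 (by simpa using hne)
      have hx1 : ((x : P.carrier) : Coord s).1 = 0 := x.2
      have hx2 : ((x : P.carrier) : Coord s).2.1 = 0 := hx
      simp [g3s_form_apply, hx1, hx2] at h4
    simpa using LinearMap.finrank_le_finrank_of_injective hinj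
  omega

/-- Two `k`-planes whose `u`-projections have the same dimension `≥ 2` have conjugate higher order
curvature operators. -/
lemma isConj_sum_g3s_curvature (p : Coord s) {e e' : Fin k → Coord s} {r : ℕ} (hr : 2 ≤ r)
    (h : finrank ℝ (Submodule.span ℝ (Set.range fun i => (e i).1)) = r)
    (h' : finrank ℝ (Submodule.span ℝ (Set.range fun i => (e' i).1)) = r) :
    IsConj
      (∑ i, ∑ j, (g3s s).curvature p (e i) (e j) * (g3s s).curvature p (e i) (e j))
      (∑ i, ∑ j, (g3s s).curvature p (e' i) (e' j) * (g3s s).curvature p (e' i) (e' j)) := by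
  refine isConj_of_sq_eq_zero (sum_g3s_curvature_sq p e) (sum_g3s_curvature_sq p e') ?_
  rw [finrank_range_sum_g3s_curvature, finrank_range_sum_g3s_curvature,
    finrank_range_wedgeSq _ (by omega), finrank_range_wedgeSq _ (by omega), h, h']

/-- On a spacelike `2`-plane `R(e₁, e₂)²` has rank `2`, as half the higher order curvature
operator. -/
lemma finrank_range_g3s_curvature_sq (P : DefinitePlane ((g3s s).form p) 1 2)
    (e : Module.Basis (Fin 2) ℝ P.carrier) :
    finrank ℝ (LinearMap.range ((g3s s).curvature p (e 0) (e 1) ^ 2)) = 2 := by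
  have h := finrank_span_fst_spacelike P e
  have h1 := finrank_range_sum_g3s_curvature p fun i => (e i : Coord s)
  rw [finrank_range_wedgeSq _ h.ge, h] at h1
  rwa [sum_sq_eq_two_smul_sq (g3s_curvature_antisymm p) fun i => (e i : Coord s),
    LinearMap.range_smul _ _ two_ne_zero] at h1

/-- The rank of `R(e₁, e₂)` is at most `4` and the rank of its square is `2`, so that there are two
Jordan blocks of size `3`, all others having size `1`. -/
lemma g3s_isSpacelikeJordanIvanovPetrova : (g3s s).IsSpacelikeJordanIvanovPetrova := by
  rintro p P P' A A' ⟨e, -, -, rfl⟩ ⟨e', -, -, rfl⟩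
  have h := finrank_range_g3s_curvature_sq P.toDefinitePlane e
  have h' := finrank_range_g3s_curvature_sq P'.toDefinitePlane e'
  refine isConj_of_cube_eq_zero (g3s_curvature_pow_three _ _ _) (g3s_curvature_pow_three _ _ _)
    ?_ ?_ (h.trans h'.symm)
  · rw [h]; exact finrank_range_g3s_curvature_le _ _ _
  · rw [h']; exact finrank_range_g3s_curvature_le _ _ _

lemma g3s_hasSpacelikeRank : (g3s s).HasSpacelikeRank 4 := by
  rintro p P A ⟨e, -, -, rfl⟩
  have h := finrank_range_g3s_curvature_sq P.toDefinitePlane e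
  have h1 := (exists_equiv_of_cube_eq_zero (g3s_curvature_pow_three p (e 0) (e 1))
    (by rw [h]; exact finrank_range_g3s_curvature_le _ _ _)).1
  rwa [h] at h1

lemma g3s_isSpacelikeJordanStanilov (hk : 2 ≤ k) : (g3s s).IsSpacelikeJordanStanilov k := by
  rintro p P P' A A' ⟨e, -, rfl⟩ ⟨e', -, rfl⟩
  exact isConj_sum_g3s_curvature p hk (finrank_span_fst_spacelike P e)
    (finrank_span_fst_spacelike P' e')

lemma g3s_isTimelikeJordanStanilov (hs : 2 ≤ s) : (g3s s).IsTimelikeJordanStanilov (2 * s) := by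
  rintro p P P' A A' ⟨e, -, rfl⟩ ⟨e', -, rfl⟩
  exact isConj_sum_g3s_curvature p hs (finrank_span_fst_maximal_timelike P e)
    (finrank_span_fst_maximal_timelike P' e')

end DefinitePlanes

/-! ### Timelike coordinate planes at the origin -/

section Frame

variable {s k : ℕ}

/-- A maximal orthonormal family of timelike vectors at the origin: `∂_i^u - ∂_i^v / 2`, followed
by `∂_i^t`. -/
def timelikeFrame (s : ℕ) : Fin s ⊕ Fin s → Coord s :=
  Sum.elim (fun i => (Pi.single i 1, 0, Pi.single i (-1 / 2))) (fun i => (0, Pi.single i 1, 0))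

lemma form_timelikeFrame (a b : Fin s ⊕ Fin s) :
    (g3s s).form 0 (timelikeFrame s a) (timelikeFrame s b) = if a = b then -1 else 0 := by
  rcases a with i | i <;> rcases b with j | j <;>
    simp [g3s_form_apply, timelikeFrame, Pi.single_apply, eq_comm] <;> split_ifs <;> norm_num

/-- The Stanilov condition at the origin, evaluated on two coordinate planes of the timelike frame:
the higher order curvature operators are conjugate, hence of equal rank. -/
lemma finrank_wedgeSq_eq_of_isTimelikeJordanStanilov
    (h : IsJordanStanilov ((g3s s).form 0) ((g3s s).curvature 0) (-1) k)
    {c c' : Fin k → Fin s ⊕ Fin s} (hc : c.Injective) (hc' : c'.Injective) :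
    finrank ℝ (LinearMap.range (wedgeSq fun i => (timelikeFrame s (c i)).1)) =
      finrank ℝ (LinearMap.range (wedgeSq fun i => (timelikeFrame s (c' i)).1)) := by
  obtain ⟨P, e, he, hec⟩ := exists_timelike_plane (B := (g3s s).form 0)
    (f := fun i => timelikeFrame s (c i)) fun i j => by
      rw [form_timelikeFrame]; simp only [hc.eq_iff]
  obtain ⟨P', e', he', hec'⟩ := exists_timelike_plane (B := (g3s s).form 0)
    (f := fun i => timelikeFrame s (c' i)) fun i j => by
      rw [form_timelikeFrame]; simp only [hc'.eq_iff]
  have h1 := finrank_range_eq_of_isConj (h P P' _ _ ⟨e, he, rfl⟩ ⟨e', he', rfl⟩)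
  have hfst : (fun i => (e i : Coord s).1) = fun i => (timelikeFrame s (c i)).1 :=
    funext fun i => by rw [hec i]
  have hfst' : (fun i => (e' i : Coord s).1) = fun i => (timelikeFrame s (c' i)).1 :=
    funext fun i => by rw [hec' i]
  rwa [finrank_range_sum_g3s_curvature 0 fun i => (e i : Coord s),
    finrank_range_sum_g3s_curvature 0 fun i => (e' i : Coord s), hfst, hfst'] at h1

/-- For `k < 2s` one coordinate plane of the timelike frame has a `u`-projection of the largest
possible dimension `min k s ≥ 2` and another one of the smallest possible dimension
`max 0 (k - s)`. -/
lemma eq_of_isJordanStanilov_timelike (hs : 2 ≤ s) (hk : 2 ≤ k) (hks : k ≤ 2 * s)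
    (h : IsJordanStanilov ((g3s s).form 0) ((g3s s).curvature 0) (-1) k) : k = 2 * s := by
  let c : Fin k → Fin s ⊕ Fin s := fun i => finSumFinEquiv.symm (i.castLE (by omega))
  have hc : c.Injective := finSumFinEquiv.symm.injective.comp (Fin.castLE_injective _)
  have hc' : (Sum.swap ∘ c).Injective := Sum.swap_rightInverse.injective.comp hc
  have hcl : ∀ (i : Fin k) (hi : (i : ℕ) < s), c i = Sum.inl ⟨i, hi⟩ := fun i hi => by
    rw [Equiv.symm_apply_eq]; rfl
  have hcr : ∀ (i : Fin k) (hi : ¬ (i : ℕ) < s), c i = Sum.inr ⟨i - s, by omega⟩ := fun i hi => by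
    rw [Equiv.symm_apply_eq, finSumFinEquiv_apply_right]
    ext
    simp
    omega
  have heq := finrank_wedgeSq_eq_of_isTimelikeJordanStanilov h hc hc'
  have hmax : min k s ≤ finrank ℝ
      (Submodule.span ℝ (Set.range fun i => (timelikeFrame s (c i)).1)) := by
    have hli : LinearIndependent ℝ fun i : Fin (min k s) =>
        (Pi.single (i.castLE (min_le_right k s)) 1 : Fin s → ℝ) :=
      (Pi.linearIndependent_single_one (Fin s) ℝ).comp _ (Fin.castLE_injective _)
    have h1 := finrank_span_eq_card hli
    rw [Fintype.card_fin] at h1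
    rw [← h1]
    refine Submodule.finrank_mono (Submodule.span_mono ?_)
    rintro _ ⟨i, rfl⟩
    refine ⟨i.castLE (min_le_left k s), ?_⟩
    have hi : (i : ℕ) < s := by omega
    simp only [hcl (i.castLE (min_le_left k s)) hi, timelikeFrame, Sum.elim_inl]
    rfl
  have hmin : finrank ℝ (Submodule.span ℝ
      (Set.range fun i => (timelikeFrame s ((Sum.swap ∘ c) i)).1)) ≤ k - s := by
    have hle : Submodule.span ℝ (Set.range fun i => (timelikeFrame s ((Sum.swap ∘ c) i)).1) ≤
        Submodule.span ℝ (Set.range fun i : Fin (k - s) =>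
          (Pi.single ⟨i, by omega⟩ 1 : Fin s → ℝ)) := by
      rw [Submodule.span_le]
      rintro _ ⟨i, rfl⟩
      by_cases hi : (i : ℕ) < s
      · simp [hcl i hi, timelikeFrame]
      · refine Submodule.subset_span ⟨⟨i - s, by omega⟩, ?_⟩
        simp [hcr i hi, timelikeFrame]
    exact (Submodule.finrank_mono hle).trans ((finrank_range_le_card _).trans (by simp))
  have h1 := finrank_range_wedgeSq (fun i => (timelikeFrame s (c i)).1) (by omega)
  have h2 := finrank_range_wedgeSq_le fun i => (timelikeFrame s ((Sum.swap ∘ c) i)).1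
  omega

end Frame

/-! ### The signature of `g_{3s}` -/

section Signature

variable {s : ℕ}

lemma le_sigNeg_g3s (p : Coord s) : 2 * s ≤ sigNeg ((g3s s).form p).toQuadraticMap := by
  -- `(a, b, (u ⬝ᵥ t - 1/2) a)` has square length `-|a|² - |b|²`
  let N : ((Fin s → ℝ) × (Fin s → ℝ)) →ₗ[ℝ] Coord s := (LinearMap.fst ℝ _ _).prod
    ((LinearMap.snd ℝ _ _).prod ((p.1 ⬝ᵥ p.2.1 - 1 / 2) • LinearMap.fst ℝ _ _))
  have hN : Function.Injective N := by
    rw [injective_iff_map_eq_zero]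
    rintro ⟨a, b⟩ h
    exact Prod.ext (congrArg (fun z : Coord s => z.1) h) (congrArg (fun z : Coord s => z.2.1) h)
  have hr := LinearMap.finrank_range_of_inj hN
  rw [Module.finrank_prod, Module.finrank_fin_fun] at hr
  rw [two_mul, ← hr]
  refine le_sigNeg_of_negDef (V := LinearMap.range N) (Q := ((g3s s).form p).toQuadraticMap) ?_
  rintro ⟨_, ⟨a, b⟩, rfl⟩ hne
  have hab : a ≠ 0 ∨ b ≠ 0 := by
    by_contra! h
    exact hne (Subtype.ext (by rw [h.1, h.2]; exact map_zero N))
  change 0 < -(g3s s).form p (a, b, (p.1 ⬝ᵥ p.2.1 - 1 / 2) • a) (a, b, (p.1 ⬝ᵥ p.2.1 - 1 / 2) • a)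
  have : -(g3s s).form p (a, b, (p.1 ⬝ᵥ p.2.1 - 1 / 2) • a) (a, b, (p.1 ⬝ᵥ p.2.1 - 1 / 2) • a) =
      a ⬝ᵥ a + b ⬝ᵥ b := by
    simp only [g3s_form_apply, dotProduct_smul, smul_dotProduct, smul_eq_mul]
    ring
  rw [this]
  have ha := dotProduct_self_nonneg_real a
  have hb := dotProduct_self_nonneg_real b
  rcases hab with h | h
  · exact add_pos_of_pos_of_nonneg (ha.lt_of_ne' (mt dotProduct_self_eq_zero.1 h)) hb
  · exact add_pos_of_nonneg_of_pos ha (hb.lt_of_ne' (mt dotProduct_self_eq_zero.1 h))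

lemma le_sigPos_g3s (p : Coord s) : s ≤ sigPos ((g3s s).form p).toQuadraticMap := by
  -- `(a, 0, (u ⬝ᵥ t + 1/2) a)` has square length `|a|²`
  let N : (Fin s → ℝ) →ₗ[ℝ] Coord s := LinearMap.id.prod
    ((0 : (Fin s → ℝ) →ₗ[ℝ] (Fin s → ℝ)).prod ((p.1 ⬝ᵥ p.2.1 + 1 / 2) • LinearMap.id))
  have hN : Function.Injective N := fun a b h => congrArg Prod.fst h
  have hr := LinearMap.finrank_range_of_inj hN
  rw [Module.finrank_fin_fun] at hr
  conv_lhs => rw [← hr]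
  refine le_sigPos_of_posDef (V := LinearMap.range N) (Q := ((g3s s).form p).toQuadraticMap) ?_
  rintro ⟨_, a, rfl⟩ hne
  have ha0 : a ≠ 0 := by
    rintro rfl
    exact hne (Subtype.ext (map_zero N))
  change 0 < (g3s s).form p (a, 0, (p.1 ⬝ᵥ p.2.1 + 1 / 2) • a) (a, 0, (p.1 ⬝ᵥ p.2.1 + 1 / 2) • a)
  have : (g3s s).form p (a, 0, (p.1 ⬝ᵥ p.2.1 + 1 / 2) • a) (a, 0, (p.1 ⬝ᵥ p.2.1 + 1 / 2) • a) =
      a ⬝ᵥ a := by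
    simp only [g3s_form_apply, dotProduct_smul, smul_dotProduct, smul_eq_mul, dotProduct_zero]
    ring
  rw [this]
  exact (dotProduct_self_nonneg_real a).lt_of_ne' (mt dotProduct_self_eq_zero.1 ha0)

lemma g3s_hasSignature : (g3s s).HasSignature (2 * s) s := by
  intro p
  have h1 := le_sigNeg_g3s p
  have h2 := le_sigPos_g3s p
  have h3 := QuadraticForm.sigPos_add_sigNeg_add_radical (Q := ((g3s s).form p).toQuadraticMap)
  simp only [Module.finrank_prod, Module.finrank_fin_fun] at h3
  omega

end Signature

end

theorem theorem1p7 (s : ℕ) (hs : 2 ≤ s) :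
    (g3s s).HasSignature (2 * s) s ∧
    ((g3s s).IsSpacelikeJordanIvanovPetrova ∧ (g3s s).HasSpacelikeRank 4) ∧
    ¬ (g3s s).IsTimelikeJordanIvanovPetrova ∧
    (∀ k : ℕ, 2 ≤ k → k ≤ s → (g3s s).IsSpacelikeJordanStanilov k) ∧
    (∀ k : ℕ, 2 ≤ k → k ≤ 2 * s → ((g3s s).IsTimelikeJordanStanilov k ↔ k = 2 * s)) := by
  refine ⟨g3s_hasSignature, ⟨g3s_isSpacelikeJordanIvanovPetrova, g3s_hasSpacelikeRank⟩,
    fun h => ?_, fun k hk _ => g3s_isSpacelikeJordanStanilov hk, fun k hk hks => ⟨fun h =>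
      eq_of_isJordanStanilov_timelike hs hk hks (h 0), ?_⟩⟩
  · have h2 := eq_of_isJordanStanilov_timelike hs le_rfl (by omega)
      ((h 0).isJordanStanilov_two (g3s_curvature_antisymm 0))
    omega
  · rintro rfl
    exact g3s_isTimelikeJordanStanilov hs
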